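/- Let $\Omega\subset\mathbb{R}^2$ be a bounded polygonal domain with Lipschitz boundary $\Gamma$, let $\{\mathcal{T}_h\}_{h}$ be a shape-regular family of conforming triangulations of $\bar\Omega$ with edge sets $\mathcal{E}_h$, and let $k\ge 1$, $\tau>0$, $\varepsilon\in\{-1,1\}$. Put $h_K=\operatorname{diam}K$, let $n$ be the outward unit normal on $\partial K$, and fix on each edge a unit tangent vector $t$ (the same for both triangles sharing the edge); the index $t$ denotes the component along it. Let $$V_h=\{v_h\in H(\mathrm{div},\Omega): v_h|_K\in[\mathbb{P}_k(K)]^2\ \forall K\in\mathcal{T}_h\}\times\{\tilde v_h\in L^2(\mathcal{E}_h):\tilde v_h|_E\in\mathbb{P}_{k-1}(E)\ \forall E\in\mathcal{E}_h,\ \tilde v_h=0\text{ on }\Gamma\},$$ $$Q_h^k=\{q_h\in L^2(\Omega): q_h|_K\in\mathbb{P}_k(K)\ \forall K\in\mathcal{T}_h\}.$$ Let $\Phi^{k-1}$ be the edgewise $L^2$-projection onto $\mathbb{P}_{k-1}(E)$ and $\Psi^{k-1}$ the elementwise $L^2$-projection onto $\mathbb{P}_{k-1}(K)$. For $\nu>0$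 define $$\begin{aligned}a((w_h,\tilde w_h),(v_h,\tilde v_h))=\sum_{K\in\mathcal{T}_h}\Big(&\int_K\nu\nabla w_h:\nabla v_h\,dx-\int_{\partial K}\nu(\partial_n w_h)_t((v_h)_t-\tilde v_h)\,ds+\varepsilon\int_{\partial K}\nu((w_h)_t-\tilde w_h)(\partial_n v_h)_t\,ds\\&+\nu\frac{\tau}{h_K}\int_{\partial K}\Phi^{k-1}((w_h)_t-\tilde w_h)\,\Phi^{k-1}((v_h)_t-\tilde v_h)\,ds\Big),\end{aligned}$$ $$b((v_h,\tilde v_h),q_h)=-\sum_{K\in\mathcal{T}_h}\int_K q_h\nabla\cdot v_h\,dx,\qquad s(r_h,q_h)=\frac1\nu\int_\Omega(r_h-\Psi^{k-1}r_h)(q_h-\Psi^{k-1}q_h)\,dx,$$ $$A((w_h,\tilde w_h,r_h),(v_h,\tilde v_h,q_h))=a((w_h,\tilde w_h),(v_h,\tilde v_h))+b((v_h,\tilde v_h),r_h)+b((w_h,\tilde w_h),q_h)-s(r_h,q_h),$$ and $$|||(w_h,\tilde w_h)|||^2=\nu\sum_{K\in\mathcal{T}_h}\Big(|w_h|_{H^1(K)}^2+h_K\|\partial_n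 w_h\|_{\partial K}^2+\frac{\tau}{h_K}\|\Phi^{k-1}((w_h)_t-\tilde w_h)\|_{\partial K}^2\Big),$$ $$|||(w_h,\tilde w_h,r_h)|||_h=|||(w_h,\tilde w_h)|||+\nu^{-1/2}\|r_h\|_{\Omega}.$$ Then there exists a constant $C>0$, independent of $\nu$ and of the triangulation $\mathcal{T}_h$ in the family, such that for all $(w_h,\tilde w_h),(v_h,\tilde v_h)\in V_h$ and all $r_h,q_h\in Q_h^k$, $$|A((w_h,\tilde w_h,r_h),(v_h,\tilde v_h,q_h))|\le C\,|||(w_h,\tilde w_h,r_h)|||_h\,|||(v_h,\tilde v_h,q_h)|||_h .$$ -/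

import Mathlib

open MeasureTheory Set
open scoped ContDiff

noncomputable section

namespace HdG

/-- The Euclidean plane. -/
abbrev Pt : Type := EuclideanSpace ℝ (Fin 2)

/-! ### Domain and triangulations -/

/-- `Ω` has a Lipschitz boundary: near every boundary point, and up to a rigid motion `e`,
`Ω` is the strict epigraph of a Lipschitz function of one variable. -/
def HasLipschitzBoundary (Ω : Set Pt) : Prop :=
  ∀ x ∈ frontier Ω, ∃ (e : Pt ≃ᵃⁱ[ℝ] Pt) (U : Set Pt) (L : NNReal) (φ : ℝ → ℝ),
    IsOpen U ∧ x ∈ U ∧ LipschitzWith L φ ∧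
      ∀ y ∈ U, (y ∈ Ω ↔ φ (e y 0) < e y 1)

/-- A (bounded) open polygonal domain of the plane with Lipschitz boundary. -/
structure IsLipschitzPolygon (Ω : Set Pt) : Prop where
  isOpen : IsOpen Ω
  isConnected : IsConnected Ω
  isBounded : Bornology.IsBounded Ω
  polygonal : ∃ S : Finset (Pt × Pt), frontier Ω = ⋃ s ∈ S, segment ℝ s.1 s.2
  lipschitz : HasLipschitzBoundary Ω

/-- A conforming triangulation of `closure Ω`: a finite simplicial complex with underlying space
`closure Ω`, all of whose faces (given by their vertex sets) are faces of triangles. -/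
structure Triangulation (Ω : Set Pt) extends Geometry.SimplicialComplex ℝ Pt where
  finite_faces : faces.Finite
  pure : ∀ s ∈ faces, ∃ K ∈ faces, s ⊆ K ∧ K.card = 3
  space_eq : toSimplicialComplex.space = closure Ω

/-- The closed simplex with a given set of vertices. -/
def hull (s : Finset Pt) : Set Pt := convexHull ℝ (s : Set Pt)

/-- The triangles of a triangulation, each given by its three vertices. -/
def Triangulation.elements {Ω : Set Pt} (T : Triangulation Ω) : Finset (Finset Pt) :=
  T.finite_faces.toFinset.filter (fun s => s.card = 3)

/-- The edges of a triangulation, each given by its two endpoints. -/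
def Triangulation.edges {Ω : Set Pt} (T : Triangulation Ω) : Finset (Finset Pt) :=
  T.finite_faces.toFinset.filter (fun s => s.card = 2)

/-- The three edges of a triangle. -/
def edgesOf (K : Finset Pt) : Finset (Finset Pt) := K.powersetCard 2

/-- The diameter `h_K`. -/
def diam (K : Finset Pt) : ℝ := Metric.diam (hull K)

/-- A regular (that is, shape-regular) family of triangulations: the ratio between the diameter of
a triangle and the diameter of its largest inscribed disc is bounded over the whole family. -/
def IsRegularFamily {Ω : Set Pt} {ι : Type*} (T : ι → Triangulation Ω) : Prop :=
  ∃ σ : ℝ, ∀ i, ∀ K ∈ (T i).elements, ∃ (c : Pt) (r : ℝ),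
    Metric.closedBall c r ⊆ hull K ∧ diam K ≤ σ * (2 * r)

/-- A choice of a unit tangent vector for every edge of the triangulation. The vector depends on the
edge only, so that both triangles sharing an edge use the same one. -/
def IsTangentField {Ω : Set Pt} (T : Triangulation Ω) (t : Finset Pt → Pt) : Prop :=
  ∀ E ∈ T.edges, ‖t E‖ = 1 ∧ ∀ a ∈ E, ∀ b ∈ E, ∃ c : ℝ, b - a = c • t E

/-- `n` is the unit normal to the edge `E` of the triangle `K` that points out of `K`. -/
def IsOutwardNormal (K E : Finset Pt) (n : Pt) : Prop :=
  ‖n‖ = 1 ∧ (∀ a ∈ E, ∀ b ∈ E, inner ℝ n (b - a) = 0) ∧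
    ∀ a ∈ E, ∀ x ∈ K, inner ℝ n (x - a) ≤ 0

open Classical in
/-- The outward unit normal to the edge `E` of the triangle `K`. -/
def outwardNormal (K E : Finset Pt) : Pt :=
  if h : ∃ n, IsOutwardNormal K E n then h.choose else 0

/-- Arc length on an edge. -/
def edgeMeasure (E : Finset Pt) : Measure Pt := (Measure.hausdorffMeasure 1).restrict (hull E)

/-- Lebesgue measure on a triangle. -/
def elemMeasure (K : Finset Pt) : Measure Pt := volume.restrict (hull K)

/-- `∫_{∂K}` of a quantity `f E x` that may depend on the edge `E` of `K` containing `x`. -/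
def boundaryIntegral (K : Finset Pt) (f : Finset Pt → Pt → ℝ) : ℝ :=
  ∑ E ∈ edgesOf K, ∫ x, f E x ∂(edgeMeasure E)

/-! ### Polynomials and projections -/

/-- Real polynomial functions on the plane of total degree at most `k`; their restrictions to a
triangle `K` or to an edge `E` are the elements of `P_k(K)`, `P_k(E)`. -/
def poly (k : ℕ) : Set (Pt → ℝ) :=
  {f | ∃ p : MvPolynomial (Fin 2) ℝ, p.totalDegree ≤ k ∧
    ∀ x : Pt, f x = MvPolynomial.eval (fun i => x i) p}

/-- Polynomial vector fields on the plane whose components have degree at most `k`. -/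
def vpoly (k : ℕ) : Set (Pt → Pt) := {f | ∀ i, (fun x => f x i) ∈ poly k}

/-- `φ` is the `L²(μ)`-projection of `w` onto the polynomials of degree at most `k`. -/
def IsL2Proj (μ : Measure Pt) (k : ℕ) (w φ : Pt → ℝ) : Prop :=
  φ ∈ poly k ∧ ∀ v ∈ poly k, ∫ x, φ x * v x ∂μ = ∫ x, w x * v x ∂μ

open Classical in
/-- The `L²(μ)`-projection onto the polynomials of degree at most `k`. -/
def l2Proj (μ : Measure Pt) (k : ℕ) (w : Pt → ℝ) : Pt → ℝ :=
  if h : ∃ φ, IsL2Proj μ k w φ then h.choose else 0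

/-- The projection `Φ_E^k : L²(E) → P_k(E)`. -/
def edgeProj (k : ℕ) (E : Finset Pt) (w : Pt → ℝ) : Pt → ℝ := l2Proj (edgeMeasure E) k w

/-- The projection `Ψ_K^k : L²(K) → P_k(K)`. -/
def elemProj (k : ℕ) (K : Finset Pt) (w : Pt → ℝ) : Pt → ℝ := l2Proj (elemMeasure K) k w

/-- The projection `Ψ^k`, equal to `Ψ_K^k` in the interior of each triangle `K`. -/
def globalProj {Ω : Set Pt} (T : Triangulation Ω) (k : ℕ) (q : Pt → ℝ) : Pt → ℝ :=
  fun x => ∑ K ∈ T.elements, (interior (hull K)).indicator (elemProj k K q) x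

open Classical in
/-- The polynomial field that coincides with `v` almost everywhere on the triangle `K`, for a field
`v` that is polynomial of degree at most `k` there. Its values on `∂K` are the traces of `v|_K`, and
its derivatives are those of `v|_K`. -/
def localPoly (k : ℕ) (K : Finset Pt) (v : Pt → Pt) : Pt → Pt :=
  if h : ∃ p ∈ vpoly k, v =ᵐ[elemMeasure K] p then h.choose else 0

/-! ### The outward normals and the `L²`-projections exist -/

theorem exists_isOutwardNormal {K E : Finset Pt} (hE : E ∈ edgesOf K) (hK : K.card = 3) :
    ∃ n, IsOutwardNormal K E n := by
  obtain ⟨hEK, hE2⟩ := Finset.mem_powersetCard.1 hE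
  obtain ⟨a, b, hab, rfl⟩ := Finset.card_eq_two.1 hE2
  obtain ⟨c, hc⟩ : ∃ c, K \ {a, b} = {c} := by
    apply Finset.card_eq_one.1
    rw [Finset.card_sdiff_of_subset hEK, hK, hE2]
  have hKc : ∀ x ∈ K, x = a ∨ x = b ∨ x = c := by
    intro x hx
    by_cases h : x ∈ ({a, b} : Finset Pt)
    · simp at h; tauto
    · have : x ∈ K \ {a, b} := Finset.mem_sdiff.2 ⟨hx, h⟩
      rw [hc] at this; simp at this; tauto
  -- a unit vector orthogonal to the edge
  obtain ⟨d, hd0, hd⟩ : ∃ d : Pt, d ≠ 0 ∧ inner ℝ d (b - a) = 0 := by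
    refine ⟨!₂[-(b - a) 1, (b - a) 0], ?_, ?_⟩
    · intro h
      apply hab
      have h0 := congrArg (fun z : Pt => z 0) h
      have h1 := congrArg (fun z : Pt => z 1) h
      simp at h0 h1
      ext i; fin_cases i <;> simp <;> linarith
    · simp [PiLp.inner_apply, Fin.sum_univ_two]; ring
  obtain ⟨n, hn1, hn, hnc⟩ : ∃ n : Pt, ‖n‖ = 1 ∧ inner ℝ n (b - a) = 0 ∧
      inner ℝ n (c - a) ≤ 0 := by
    have hu : ‖(‖d‖⁻¹ • d)‖ = 1 := norm_smul_inv_norm hd0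
    rcases le_total (inner ℝ (‖d‖⁻¹ • d) (c - a)) 0 with h | h
    · exact ⟨_, hu, by simp [real_inner_smul_left, hd], h⟩
    · exact ⟨-(‖d‖⁻¹ • d), by rw [norm_neg, hu], by simp [real_inner_smul_left, hd],
        by rw [inner_neg_left]; linarith⟩
  have hcb : inner ℝ n (c - b) ≤ 0 := by
    have : c - b = (c - a) - (b - a) := by abel
    rw [this, inner_sub_right, hn]; linarith
  have hba : inner ℝ n (a - b) = 0 := by
    rw [← neg_sub, inner_neg_right, hn, neg_zero]
  refine ⟨n, hn1, ?_, ?_⟩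
  · intro x hx y hy
    simp at hx hy
    rcases hx with rfl | rfl <;> rcases hy with rfl | rfl <;> simp [hn, hba]
  · intro x hx y hy
    simp at hx
    rcases hx with rfl | rfl <;> rcases hKc y hy with rfl | rfl | rfl <;>
      simp [hn, hba, hnc, hcb]

theorem continuous_of_mem_poly {k : ℕ} {f : Pt → ℝ} (hf : f ∈ poly k) : Continuous f := by
  obtain ⟨p, -, hp⟩ := hf
  have : f = fun x : Pt => MvPolynomial.eval (fun i => x i) p := funext hp
  rw [this]
  exact (MvPolynomial.continuous_eval p).comp (by fun_prop)

theorem memLp_of_mem_poly {k : ℕ} {f : Pt → ℝ} (hf : f ∈ poly k) {S : Set Pt} (hS : IsCompact S)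
    {μ : Measure Pt} (hμ : μ S < ⊤) : MemLp f 2 (μ.restrict S) := by
  have : IsFiniteMeasure (μ.restrict S) := ⟨by simpa using hμ⟩
  obtain ⟨C, hC⟩ := hS.exists_bound_of_continuousOn (continuous_of_mem_poly hf).continuousOn
  exact MemLp.of_bound (continuous_of_mem_poly hf).aestronglyMeasurable C
    ((ae_restrict_iff' hS.measurableSet).2 (Filter.Eventually.of_forall hC))

theorem exists_isL2Proj {μ : Measure Pt} {S : Set Pt} (hS : IsCompact S) (hμ : μ S < ⊤) (k : ℕ)
    {w : Pt → ℝ} (hw : MemLp w 2 (μ.restrict S)) : ∃ φ, IsL2Proj (μ.restrict S) k w φ := by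
  classical
  set m := μ.restrict S
  have hmem : ∀ p : MvPolynomial.restrictTotalDegree (Fin 2) ℝ k,
      (fun x : Pt => MvPolynomial.eval (fun i => x i) p.1) ∈ poly k := fun p =>
    ⟨p.1, (MvPolynomial.mem_restrictTotalDegree _ _ _).1 p.2, fun _ => rfl⟩
  have hL : ∀ p : MvPolynomial.restrictTotalDegree (Fin 2) ℝ k, MemLp (fun x : Pt => MvPolynomial.eval (fun i => x i) p.1) 2 m :=
    fun p => memLp_of_mem_poly (hmem p) hS hμ
  let F : MvPolynomial.restrictTotalDegree (Fin 2) ℝ k →ₗ[ℝ] Lp ℝ 2 m :=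
    { toFun := fun p => (hL p).toLp _
      map_add' := fun p q => by
        rw [← MemLp.toLp_add (hL p) (hL q)]
        exact MemLp.toLp_congr _ _ (Filter.Eventually.of_forall fun x => by simp)
      map_smul' := fun c p => by
        rw [RingHom.id_apply, ← MemLp.toLp_const_smul c (hL p)]
        exact MemLp.toLp_congr _ _ (Filter.Eventually.of_forall fun x => by simp) }
  have : FiniteDimensional ℝ (LinearMap.range F) := inferInstance
  obtain ⟨p, hp⟩ : (LinearMap.range F).starProjection (hw.toLp w) ∈ LinearMap.range F :=
    Submodule.starProjection_apply_mem _ _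
  refine ⟨_, hmem p, ?_⟩
  rintro v ⟨q, hq, hv⟩
  have hvF : v = fun x : Pt => MvPolynomial.eval (fun i => x i) q := funext hv
  let q' : MvPolynomial.restrictTotalDegree (Fin 2) ℝ k :=
    ⟨q, (MvPolynomial.mem_restrictTotalDegree _ _ _).2 hq⟩
  have h0 := (LinearMap.range F).starProjection_inner_eq_zero (hw.toLp w) (F q') ⟨q', rfl⟩
  rw [← hp, inner_sub_left, sub_eq_zero, L2.inner_def, L2.inner_def] at h0
  have e1 := hw.coeFn_toLp
  have e2 := (hL p).coeFn_toLp
  have e3 := (hL q').coeFn_toLp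
  have i1 : ∫ x, inner ℝ ((hw.toLp w) x) ((F q') x) ∂m = ∫ x, w x * v x ∂m := by
    apply integral_congr_ae
    filter_upwards [e1, e3] with x h1 h3
    change inner ℝ ((hw.toLp w) x) (((hL q').toLp _ : Lp ℝ 2 m) x) = _
    rw [h1, h3, hvF]; simp [q', mul_comm]
  have i2 : ∫ x, inner ℝ ((F p) x) ((F q') x) ∂m
      = ∫ x, MvPolynomial.eval (fun i => x i) p.1 * v x ∂m := by
    apply integral_congr_ae
    filter_upwards [e2, e3] with x h1 h3
    change inner ℝ (((hL p).toLp _ : Lp ℝ 2 m) x) (((hL q').toLp _ : Lp ℝ 2 m) x) = _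
    rw [h1, h3, hvF]; simp [q', mul_comm]
  rw [← i1, ← i2]; exact h0.symm

/-! ### Discrete spaces -/

/-- `H(div, Ω)`: square integrable fields with square integrable weak divergence. -/
def MemHDiv (Ω : Set Pt) (v : Pt → Pt) : Prop :=
  MemLp v 2 (volume.restrict Ω) ∧
    ∃ g : Pt → ℝ, MemLp g 2 (volume.restrict Ω) ∧
      ∀ φ : Pt → ℝ, ContDiff ℝ ∞ φ → HasCompactSupport φ → tsupport φ ⊆ Ω →
        ∫ x in Ω, fderiv ℝ φ x (v x) = -∫ x in Ω, φ x * g x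

/-- The Brezzi-Douglas-Marini space of order `k`. -/
def BDM {Ω : Set Pt} (T : Triangulation Ω) (k : ℕ) : Set (Pt → Pt) :=
  {v | MemHDiv Ω v ∧ ∀ K ∈ T.elements, ∃ p ∈ vpoly k, v =ᵐ[elemMeasure K] p}

/-- The pressure space `Q_h^k`. -/
def Qh {Ω : Set Pt} (T : Triangulation Ω) (k : ℕ) : Set (Pt → ℝ) :=
  {q | MemLp q 2 (volume.restrict Ω) ∧
    ∀ K ∈ T.elements, ∃ p ∈ poly k, q =ᵐ[elemMeasure K] p}

/-- The multiplier space `M_{h,0}^k`: square integrable functions on the skeleton of the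
triangulation that are polynomial of degree at most `k` on each edge and vanish on `∂Ω`. -/
def Mh0 {Ω : Set Pt} (T : Triangulation Ω) (k : ℕ) : Set (Pt → ℝ) :=
  {m | (∀ E ∈ T.edges, MemLp m 2 (edgeMeasure E)) ∧
    (∀ E ∈ T.edges, ∃ p ∈ poly k, m =ᵐ[edgeMeasure E] p) ∧
    ∀ᵐ x ∂((Measure.hausdorffMeasure 1).restrict (frontier Ω)), m x = 0}

/-- The space `V_h = BDM_h^k × M_{h,0}^{k-1}`. -/
def Vh {Ω : Set Pt} (T : Triangulation Ω) (k : ℕ) : Set ((Pt → Pt) × (Pt → ℝ)) :=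
  BDM T k ×ˢ Mh0 T (k - 1)

/-! ### Bilinear forms and norms

In this section `w`, `v` are pairs (velocity, multiplier), and `t` is the field of tangents. -/

/-- The partial derivative `∂_j f_i`. -/
def pderiv (f : Pt → Pt) (i j : Fin 2) (x : Pt) : ℝ :=
  fderiv ℝ f x (EuclideanSpace.single j 1) i

/-- `∇f : ∇g`. -/
def gradDot (f g : Pt → Pt) (x : Pt) : ℝ := ∑ i, ∑ j, pderiv f i j x * pderiv g i j x

/-- `∇ · f`. -/
def dvg (f : Pt → Pt) (x : Pt) : ℝ := ∑ i, pderiv f i i x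

/-- The normal derivative `∂_n w` of `w|_K` on the edge `E` of `K`. -/
def normalDeriv (k : ℕ) (K E : Finset Pt) (w : Pt → Pt) (x : Pt) : Pt :=
  fderiv ℝ (localPoly k K w) x (outwardNormal K E)

/-- The scalar tangential component `(∂_n w)_t`. -/
def normalDerivT (t : Finset Pt → Pt) (k : ℕ) (K E : Finset Pt) (w : Pt → Pt) (x : Pt) : ℝ :=
  inner ℝ (normalDeriv k K E w x) (t E)

/-- The difference `w_t - w̃` on the edge `E` of `K`, with the trace of `w` taken from `K`. -/
def tangJump (t : Finset Pt → Pt) (k : ℕ) (K E : Finset Pt) (w : (Pt → Pt) × (Pt → ℝ))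
    (x : Pt) : ℝ :=
  inner ℝ (localPoly k K w.1 x) (t E) - w.2 x

/-- The projected difference `Φ^{k-1}(w_t - w̃)` on the edge `E` of `K`. -/
def projJump (t : Finset Pt → Pt) (k : ℕ) (K E : Finset Pt) (w : (Pt → Pt) × (Pt → ℝ)) :
    Pt → ℝ :=
  edgeProj (k - 1) E (tangJump t k K E w)

variable {Ω : Set Pt}

/-- The bilinear form `a`. -/
def formA0 (T : Triangulation Ω) (t : Finset Pt → Pt) (k : ℕ) (ν τ ε : ℝ)
    (w v : (Pt → Pt) × (Pt → ℝ)) : ℝ :=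
  ∑ K ∈ T.elements,
    ((∫ x, ν * gradDot (localPoly k K w.1) (localPoly k K v.1) x ∂(elemMeasure K))
      - boundaryIntegral K (fun E x => ν * normalDerivT t k K E w.1 x * tangJump t k K E v x)
      + ε * boundaryIntegral K (fun E x => ν * tangJump t k K E w x * normalDerivT t k K E v.1 x)
      + ν * (τ / diam K) *
          boundaryIntegral K (fun E x => projJump t k K E w x * projJump t k K E v x))

/-- The bilinear form `b`. -/
def formB (T : Triangulation Ω) (k : ℕ) (v : (Pt → Pt) × (Pt → ℝ)) (q : Pt → ℝ) : ℝ :=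
  -∑ K ∈ T.elements, ∫ x, q x * dvg (localPoly k K v.1) x ∂(elemMeasure K)

/-- The stabilising bilinear form `s`. -/
def formS (T : Triangulation Ω) (k : ℕ) (ν : ℝ) (p q : Pt → ℝ) : ℝ :=
  1 / ν * ∫ x in Ω, (p x - globalProj T (k - 1) p x) * (q x - globalProj T (k - 1) q x)

/-- The stabilised bilinear form `A`. -/
def formA (T : Triangulation Ω) (t : Finset Pt → Pt) (k : ℕ) (ν τ ε : ℝ)
    (w : (Pt → Pt) × (Pt → ℝ)) (r : Pt → ℝ) (v : (Pt → Pt) × (Pt → ℝ)) (q : Pt → ℝ) : ℝ :=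
  formA0 T t k ν τ ε w v + formB T k v r + formB T k w q - formS T k ν r q

/-- The norm `|||(w, w̃)|||`. -/
def velNorm (T : Triangulation Ω) (t : Finset Pt → Pt) (k : ℕ) (ν τ : ℝ)
    (w : (Pt → Pt) × (Pt → ℝ)) : ℝ :=
  Real.sqrt (ν * ∑ K ∈ T.elements,
    ((∫ x, gradDot (localPoly k K w.1) (localPoly k K w.1) x ∂(elemMeasure K))
      + diam K * boundaryIntegral K (fun E x => ‖normalDeriv k K E w.1 x‖ ^ 2)
      + τ / diam K * boundaryIntegral K (fun E x => projJump t k K E w x ^ 2)))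

/-- The norm `‖q‖_Ω` of `L²(Ω)`. -/
def l2Norm (Ω : Set Pt) (q : Pt → ℝ) : ℝ := Real.sqrt (∫ x in Ω, q x ^ 2)

/-- The norm `|||(w, w̃, r)|||_h`. -/
def fullNorm (T : Triangulation Ω) (t : Finset Pt → Pt) (k : ℕ) (ν τ : ℝ)
    (w : (Pt → Pt) × (Pt → ℝ)) (r : Pt → ℝ) : ℝ :=
  velNorm T t k ν τ w + 1 / Real.sqrt ν * l2Norm Ω r

end HdG

end

namespace HdG

/-! ### Polynomial functions -/

/-! Every term of the form is bounded on a single triangle by Cauchy-Schwarz, and the local bounds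
are summed by the discrete Cauchy-Schwarz inequality over triangles.

The delicate terms are the two fluxes. They contain the full jump `w_t - w̃`, while the norm
controls only its projection `Φ^{k-1}`. On an edge the normal and the tangent are constant vectors,
so `(∂_n w)_t` is a polynomial of degree at most `k - 1`, and testing the jump against it gives the
same integral as testing its projection (`boundaryIntegral_normalDerivT_mul_tangJump`). The weight
`h_K` on the normal derivative then meets `τ / h_K` on the projected jump. Their product is `τ`,
which leaves the factor `1 / √τ` of `abs_flux_le`. No trace or inverse inequality is needed.

For `b`, the pointwise bound `(∇·v)² ≤ 2 |∇v|²` suffices. The factor `√ν` in the velocity norm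
cancels `1 / √ν` in front of the pressure. For `s`, subtracting an `L²`-projection does not increase
the `L²` norm. To use this triangle by triangle, integrals over `Ω` must split into integrals over
the triangles (`Triangulation.restrict_eq_sum`), and `Ψ^{k-1}` must agree almost everywhere on each
triangle with its local projection (`globalProj_ae_eq`).

The resulting constant is `(2 + 2 / √τ) + √2 + 1`. -/

theorem poly_add {k : ℕ} {f g : Pt → ℝ} (hf : f ∈ poly k) (hg : g ∈ poly k) :
    (fun x => f x + g x) ∈ poly k := by
  obtain ⟨p, hp, hpf⟩ := hf
  obtain ⟨q, hq, hqg⟩ := hg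
  exact ⟨p + q, (MvPolynomial.totalDegree_add p q).trans (max_le hp hq), fun x => by
    simp [hpf, hqg]⟩

theorem poly_const_mul {k : ℕ} {f : Pt → ℝ} (c : ℝ) (hf : f ∈ poly k) :
    (fun x => c * f x) ∈ poly k := by
  obtain ⟨p, hp, hpf⟩ := hf
  exact ⟨c • p, (MvPolynomial.totalDegree_smul_le c p).trans hp, fun x => by simp [hpf]⟩

theorem poly_zero (k : ℕ) : (fun _ : Pt => (0 : ℝ)) ∈ poly k := ⟨0, by simp, by simp⟩

theorem poly_sum {k : ℕ} {ι : Type*} (s : Finset ι) {f : ι → Pt → ℝ} (hf : ∀ i ∈ s, f i ∈ poly k) :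
    (fun x => ∑ i ∈ s, f i x) ∈ poly k := by
  classical
  induction s using Finset.induction_on with
  | empty => simpa using poly_zero k
  | insert a s ha ih =>
    simp only [Finset.sum_insert ha]
    exact poly_add (hf _ (Finset.mem_insert_self _ _))
      (ih fun i hi => hf i (Finset.mem_insert_of_mem hi))

theorem totalDegree_pderiv_le {σ : Type*} (p : MvPolynomial σ ℝ) (j : σ) :
    (MvPolynomial.pderiv j p).totalDegree ≤ p.totalDegree - 1 := by
  refine Finset.sup_le fun m hm => ?_
  rw [MvPolynomial.mem_support_iff, MvPolynomial.coeff_pderiv] at hm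
  have h := MvPolynomial.le_totalDegree
    (MvPolynomial.mem_support_iff.2 (left_ne_zero_of_mul hm))
  rw [Finsupp.sum_add_index' (by simp) (by simp)] at h
  simp at h
  omega

/-- Identifies the analytic derivative with the formal one, so that degree bounds on
`MvPolynomial.pderiv` pass to `fderiv`. The induction step is the product rule for multiplication by
a coordinate. -/
theorem hasFDerivAt_eval (p : MvPolynomial (Fin 2) ℝ) (x : Pt) :
    HasFDerivAt (fun y : Pt => MvPolynomial.eval (fun i => y i) p)
      (∑ j, MvPolynomial.eval (fun i => x i) (MvPolynomial.pderiv j p) •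
        (EuclideanSpace.proj j : Pt →L[ℝ] ℝ)) x := by
  induction p using MvPolynomial.induction_on with
  | C a => simpa using hasFDerivAt_const a x
  | add p q hp hq =>
    simp only [map_add, add_smul, Finset.sum_add_distrib]
    exact hp.add hq
  | mul_X p i hp =>
    have hX : HasFDerivAt (fun y : Pt => y i) (EuclideanSpace.proj i : Pt →L[ℝ] ℝ) x :=
      (EuclideanSpace.proj i : Pt →L[ℝ] ℝ).hasFDerivAt
    have h := hp.mul hX
    simp only [map_mul, MvPolynomial.eval_X]
    refine h.congr_fderiv ?_
    ext y
    fin_cases i <;> simp [Fin.sum_univ_two] <;> ring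

theorem differentiable_of_mem_poly {k : ℕ} {f : Pt → ℝ} (hf : f ∈ poly k) :
    Differentiable ℝ f := by
  obtain ⟨p, -, hp⟩ := hf
  rw [show f = _ from funext hp]
  exact fun x => (hasFDerivAt_eval p x).differentiableAt

/-- The drop by one degree is what makes normal derivatives admissible test functions for `Φ^{k-1}`.
For `k = 0` the truncated bound is still correct, since the derivative vanishes. -/
theorem fderiv_mem_poly {k : ℕ} {f : Pt → ℝ} (hf : f ∈ poly k) (n : Pt) :
    (fun x => fderiv ℝ f x n) ∈ poly (k - 1) := by
  obtain ⟨p, hp, hpf⟩ := hf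
  have : (fun x => fderiv ℝ f x n) =
      fun x : Pt => ∑ j, n j * MvPolynomial.eval (fun i => x i) (MvPolynomial.pderiv j p) := by
    funext x
    rw [show f = _ from funext hpf, (hasFDerivAt_eval p x).fderiv]
    simp [mul_comm]
  rw [this]
  exact poly_sum _ fun j _ => poly_const_mul _
    ⟨_, (totalDegree_pderiv_le p j).trans (Nat.sub_le_sub_right hp 1), fun _ => rfl⟩

theorem differentiable_of_mem_vpoly {k : ℕ} {f : Pt → Pt} (hf : f ∈ vpoly k) :
    Differentiable ℝ f :=
  differentiable_euclidean.2 fun i => differentiable_of_mem_poly (hf i)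

theorem continuous_of_mem_vpoly {k : ℕ} {f : Pt → Pt} (hf : f ∈ vpoly k) : Continuous f :=
  (differentiable_of_mem_vpoly hf).continuous

theorem fderiv_mem_vpoly {k : ℕ} {f : Pt → Pt} (hf : f ∈ vpoly k) (n : Pt) :
    (fun x => fderiv ℝ f x n) ∈ vpoly (k - 1) := by
  intro i
  have : (fun x => fderiv ℝ f x n i) = fun x => fderiv ℝ (fun y => f y i) x n := by
    funext x
    have h := ((EuclideanSpace.proj i : Pt →L[ℝ] ℝ).hasFDerivAt.comp x
      (differentiable_of_mem_vpoly hf x).hasFDerivAt).fderiv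
    exact (DFunLike.congr_fun h n).symm
  rw [this]
  exact fderiv_mem_poly (hf i) n

theorem inner_mem_poly {k : ℕ} {f : Pt → Pt} (hf : f ∈ vpoly k) (t : Pt) :
    (fun x => inner ℝ (f x) t) ∈ poly k := by
  simp only [PiLp.inner_apply]
  exact poly_sum _ fun i _ => by simpa using poly_const_mul (t i) (hf i)

theorem pderiv_mem_poly {k : ℕ} {f : Pt → Pt} (hf : f ∈ vpoly k) (i j : Fin 2) :
    pderiv f i j ∈ poly (k - 1) :=
  fderiv_mem_vpoly hf _ i

theorem continuous_gradDot {k l : ℕ} {f g : Pt → Pt} (hf : f ∈ vpoly k) (hg : g ∈ vpoly l) :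
    Continuous (gradDot f g) := by
  unfold gradDot
  exact continuous_finsetSum _ fun i _ => continuous_finsetSum _ fun j _ =>
    (continuous_of_mem_poly (pderiv_mem_poly hf i j)).mul
      (continuous_of_mem_poly (pderiv_mem_poly hg i j))

theorem continuous_dvg {k : ℕ} {f : Pt → Pt} (hf : f ∈ vpoly k) : Continuous (dvg f) := by
  unfold dvg
  exact continuous_finsetSum _ fun i _ => continuous_of_mem_poly (pderiv_mem_poly hf i i)

theorem gradDot_self_nonneg (f : Pt → Pt) (x : Pt) : 0 ≤ gradDot f f x :=
  Finset.sum_nonneg fun _ _ => Finset.sum_nonneg fun _ _ => mul_self_nonneg _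

theorem abs_gradDot_le (f g : Pt → Pt) (x : Pt) :
    |gradDot f g x| ≤ √(gradDot f f x) * √(gradDot g g x) := by
  rw [← Real.sqrt_mul (gradDot_self_nonneg f x)]
  refine Real.abs_le_sqrt ?_
  -- Flattening the double sum over entries to one sum over index pairs turns the Frobenius product
  -- into an ordinary one.
  simp only [gradDot, ← Fintype.sum_prod_type', ← pow_two]
  exact Finset.sum_mul_sq_le_sq_mul_sq _ _ _

theorem dvg_sq_le (f : Pt → Pt) (x : Pt) : dvg f x ^ 2 ≤ 2 * gradDot f f x := by
  simp only [dvg, gradDot, Fin.sum_univ_two]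
  nlinarith [sq_nonneg (pderiv f 0 0 x - pderiv f 1 1 x), sq_nonneg (pderiv f 0 1 x),
    sq_nonneg (pderiv f 1 0 x)]

theorem localPoly_mem_vpoly {k : ℕ} {K : Finset Pt} {v : Pt → Pt}
    (h : ∃ p ∈ vpoly k, v =ᵐ[elemMeasure K] p) : localPoly k K v ∈ vpoly k := by
  rw [localPoly, dif_pos h]
  exact h.choose_spec.1

/-! ### Square integrable functions and projections -/

theorem abs_integral_mul_le {μ : Measure Pt} {f g : Pt → ℝ} (hf : MemLp f 2 μ)
    (hg : MemLp g 2 μ) :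
    |∫ x, f x * g x ∂μ| ≤ √(∫ x, f x ^ 2 ∂μ) * √(∫ x, g x ^ 2 ∂μ) := by
  have h := integral_mul_norm_le_Lp_mul_Lq (μ := μ) (f := f) (g := g) Real.HolderConjugate.two_two
    (by simpa using hf) (by simpa using hg)
  refine (abs_integral_le_integral_abs).trans ?_
  simpa [abs_mul, Real.sqrt_eq_rpow] using h

theorem isL2Proj_l2Proj {μ : Measure Pt} {k : ℕ} {w : Pt → ℝ} (h : ∃ φ, IsL2Proj μ k w φ) :
    IsL2Proj μ k w (l2Proj μ k w) := by
  rw [l2Proj, dif_pos h]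
  exact h.choose_spec

/-- Pythagoras: testing the projection identity with `φ` itself gives `∫ w φ = ∫ φ²`, hence `‖w -
φ‖² = ‖w‖² - ‖φ‖²`. -/
theorem IsL2Proj.integral_sub_sq_le {μ : Measure Pt} {k : ℕ} {w φ : Pt → ℝ}
    (h : IsL2Proj μ k w φ) (hw : MemLp w 2 μ) (hφ : MemLp φ 2 μ) :
    ∫ x, (w x - φ x) ^ 2 ∂μ ≤ ∫ x, w x ^ 2 ∂μ := by
  have h1 := h.2 φ h.1
  have hwφ : Integrable (fun x => w x * φ x) μ := hw.integrable_mul hφ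
  have e : ∀ x, (w x - φ x) ^ 2 = w x ^ 2 - 2 * (w x * φ x) + φ x * φ x := fun x => by ring
  simp only [e]
  have i1 : Integrable (fun x => w x ^ 2 - 2 * (w x * φ x)) μ :=
    hw.integrable_sq.sub (hwφ.const_mul 2)
  have i2 : Integrable (fun x => φ x * φ x) μ := hφ.integrable_mul hφ
  rw [integral_add i1 i2, integral_sub hw.integrable_sq (hwφ.const_mul 2), integral_const_mul, h1]
  have : 0 ≤ ∫ x, w x * φ x ∂μ := h1 ▸ integral_nonneg fun x => mul_self_nonneg _
  linarith

theorem isCompact_hull (s : Finset Pt) : IsCompact (hull s) :=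
  s.finite_toSet.isCompact_convexHull _

theorem edge_measure_lt_top {E : Finset Pt} (hE : E.card = 2) :
    (Measure.hausdorffMeasure 1 : Measure Pt) (hull E) < ⊤ := by
  obtain ⟨a, b, -, rfl⟩ := Finset.card_eq_two.1 hE
  simp [hull, convexHull_pair, hausdorffMeasure_segment, edist_lt_top]

theorem memLp_edge_of_continuous {E : Finset Pt} (hE : E.card = 2) {f : Pt → ℝ}
    (hf : Continuous f) : MemLp f 2 (edgeMeasure E) := by
  have : IsFiniteMeasure (edgeMeasure E) := ⟨by simpa [edgeMeasure] using edge_measure_lt_top hE⟩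
  obtain ⟨C, hC⟩ := (isCompact_hull E).exists_bound_of_continuousOn hf.continuousOn
  exact MemLp.of_bound hf.aestronglyMeasurable C
    ((ae_restrict_iff' (isCompact_hull E).measurableSet).2 (Filter.Eventually.of_forall hC))

theorem memLp_elem_of_continuous (K : Finset Pt) {f : Pt → ℝ}
    (hf : Continuous f) : MemLp f 2 (elemMeasure K) := by
  have : IsFiniteMeasure (elemMeasure K) :=
    ⟨by simpa [elemMeasure] using (isCompact_hull K).measure_lt_top⟩
  obtain ⟨C, hC⟩ := (isCompact_hull K).exists_bound_of_continuousOn hf.continuousOn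
  exact MemLp.of_bound hf.aestronglyMeasurable C
    ((ae_restrict_iff' (isCompact_hull K).measurableSet).2 (Filter.Eventually.of_forall hC))

theorem isL2Proj_edgeProj {E : Finset Pt} (hE : E.card = 2) (k : ℕ) {w : Pt → ℝ}
    (hw : MemLp w 2 (edgeMeasure E)) : IsL2Proj (edgeMeasure E) k w (edgeProj k E w) :=
  isL2Proj_l2Proj (exists_isL2Proj (isCompact_hull E) (edge_measure_lt_top hE) k hw)

theorem isL2Proj_elemProj (K : Finset Pt) (k : ℕ) {w : Pt → ℝ}
    (hw : MemLp w 2 (elemMeasure K)) : IsL2Proj (elemMeasure K) k w (elemProj k K w) :=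
  isL2Proj_l2Proj (exists_isL2Proj (isCompact_hull K) (isCompact_hull K).measure_lt_top k hw)

/-! ### The triangles cover the domain up to a null set -/

/-- At most two points span an affine subspace whose direction has dimension at most one, hence a
proper, null subspace of the plane. It serves both for boundary segments and for overlaps of
triangles. -/
theorem volume_convexHull_eq_zero {s : Finset Pt} (hs : s.card ≤ 2) :
    volume (convexHull ℝ (s : Set Pt)) = 0 := by
  refine measure_mono_null (convexHull_subset_affineSpan _)
    (Measure.addHaar_affineSubspace volume _ fun h => ?_)
  have h1 : vectorSpan ℝ (s : Set Pt) = ⊤ := by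
    rw [← direction_affineSpan, h, AffineSubspace.direction_top]
  have h2 : Module.finrank ℝ (vectorSpan ℝ (s : Set Pt)) ≤ 1 := by
    rcases s.eq_empty_or_nonempty with rfl | hne
    · rw [Finset.coe_empty, vectorSpan_empty, finrank_bot]
      exact zero_le_one
    · classical
      have h0 : s.card ≠ 0 := hne.card_ne_zero
      have := finrank_vectorSpan_image_finset_le ℝ (id : Pt → Pt) s (n := s.card - 1) (by omega)
      rw [Finset.coe_image, image_id] at this
      omega
  rw [h1, finrank_top, finrank_euclideanSpace_fin] at h2
  omega

theorem IsLipschitzPolygon.volume_frontier {Ω : Set Pt} (hΩ : IsLipschitzPolygon Ω) :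
    volume (frontier Ω) = 0 := by
  classical
  obtain ⟨S, hS⟩ := hΩ.polygonal
  rw [hS]
  refine (measure_biUnion_null_iff S.countable_toSet).2 fun s _ => ?_
  have := volume_convexHull_eq_zero (s := {s.1, s.2}) Finset.card_le_two
  simpa [convexHull_pair] using this

theorem Triangulation.iUnion_hull {Ω : Set Pt} (T : Triangulation Ω) :
    ⋃ K ∈ T.elements, hull K = closure Ω := by
  rw [← T.space_eq]
  apply subset_antisymm
  · refine iUnion₂_subset fun K hK => ?_
    exact T.convexHull_subset_space (by simpa using (Finset.mem_filter.1 hK).1)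
  · intro x hx
    obtain ⟨s, hs, hxs⟩ := Geometry.SimplicialComplex.mem_space_iff.1 hx
    obtain ⟨K, hK, hsK, hK3⟩ := T.pure s hs
    exact mem_iUnion₂.2 ⟨K, Finset.mem_filter.2 ⟨by simpa using hK, hK3⟩,
      convexHull_mono (Finset.coe_subset.2 hsK) hxs⟩

/-- By conformity the overlap lies in the hull of the common vertices, and distinct triangles share
at most two of them. -/
theorem Triangulation.aedisjoint {Ω : Set Pt} (T : Triangulation Ω) {K L : Finset Pt}
    (hK : K ∈ T.elements) (hL : L ∈ T.elements) (h : K ≠ L) :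
    volume (hull K ∩ hull L) = 0 := by
  classical
  obtain ⟨hKf, hK3⟩ := Finset.mem_filter.1 hK
  obtain ⟨hLf, hL3⟩ := Finset.mem_filter.1 hL
  refine measure_mono_null (T.inter_subset_convexHull (by simpa using hKf) (by simpa using hLf)) ?_
  rw [← Finset.coe_inter]
  refine volume_convexHull_eq_zero ?_
  by_contra! h2
  have hKL : K ⊆ L := Finset.inter_eq_left.1
    (Finset.eq_of_subset_of_card_le Finset.inter_subset_left (by omega))
  exact h (Finset.eq_of_subset_of_card_le hKL (by omega))

/-- Passing from `Ω` to its closure adds only the null boundary, and the closure is a union of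
triangles with null overlaps. -/
theorem Triangulation.restrict_eq_sum {Ω : Set Pt} (hΩ : IsLipschitzPolygon Ω)
    (T : Triangulation Ω) :
    (volume.restrict Ω : Measure Pt) = ∑ K ∈ T.elements, elemMeasure K := by
  have h1 : (volume.restrict Ω : Measure Pt) = volume.restrict (closure Ω) := by
    refine Measure.restrict_congr_set (ae_eq_of_subset_of_measure_ge subset_closure ?_
      hΩ.isOpen.measurableSet.nullMeasurableSet ?_)
    · rw [closure_eq_self_union_frontier]
      exact (measure_union_le _ _).trans (by rw [hΩ.volume_frontier, add_zero])
    · exact (hΩ.isBounded.isCompact_closure.measure_lt_top).ne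
  rw [h1, ← T.iUnion_hull, ← Finset.set_biUnion_coe, biUnion_eq_iUnion,
    Measure.restrict_iUnion_ae]
  · ext s hs
    rw [Measure.sum_apply _ hs, tsum_fintype, Measure.finsetSum_apply]
    exact Finset.sum_coe_sort T.elements (fun K => elemMeasure K s)
  · intro K L hKL
    exact T.aedisjoint K.2 L.2 fun h => hKL (Subtype.ext h)
  · exact fun K => (isCompact_hull _).measurableSet.nullMeasurableSet

variable {Ω : Set Pt}

/-! ### Boundary integrals -/

theorem card_of_mem_edgesOf {K E : Finset Pt} (hE : E ∈ edgesOf K) : E.card = 2 :=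
  (Finset.mem_powersetCard.1 hE).2

theorem Triangulation.mem_edges {T : Triangulation Ω} {K E : Finset Pt} (hK : K ∈ T.elements)
    (hE : E ∈ edgesOf K) : E ∈ T.edges := by
  obtain ⟨hEK, hE2⟩ := Finset.mem_powersetCard.1 hE
  obtain ⟨hKf, -⟩ := Finset.mem_filter.1 hK
  refine Finset.mem_filter.2 ⟨?_, hE2⟩
  rw [Finite.mem_toFinset] at hKf ⊢
  exact T.down_closed hKf hEK (Finset.card_pos.1 (by omega))

theorem diam_pos {K : Finset Pt} (hK : K.card = 3) : 0 < diam K := by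
  refine Metric.diam_pos ?_ (isCompact_hull K).isBounded
  obtain ⟨a, ha, b, hb, hab⟩ := Finset.one_lt_card.1 (show 1 < K.card by omega)
  exact ⟨a, subset_convexHull ℝ _ ha, b, subset_convexHull ℝ _ hb, hab⟩

theorem boundaryIntegral_const_mul (K : Finset Pt) (c : ℝ) (f : Finset Pt → Pt → ℝ) :
    boundaryIntegral K (fun E x => c * f E x) = c * boundaryIntegral K f := by
  simp only [boundaryIntegral, integral_const_mul, Finset.mul_sum]

theorem boundaryIntegral_nonneg (K : Finset Pt) {f : Finset Pt → Pt → ℝ} (hf : ∀ E x, 0 ≤ f E x) :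
    0 ≤ boundaryIntegral K f :=
  Finset.sum_nonneg fun _ _ => integral_nonneg (hf _)

/-- Cauchy-Schwarz on each edge, then once more for the sum over the edges. -/
theorem abs_boundaryIntegral_mul_le {K : Finset Pt} {f g : Finset Pt → Pt → ℝ}
    (hf : ∀ E ∈ edgesOf K, MemLp (f E) 2 (edgeMeasure E))
    (hg : ∀ E ∈ edgesOf K, MemLp (g E) 2 (edgeMeasure E)) :
    |boundaryIntegral K (fun E x => f E x * g E x)| ≤
      √(boundaryIntegral K (fun E x => f E x ^ 2)) *
        √(boundaryIntegral K (fun E x => g E x ^ 2)) := by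
  refine (Finset.abs_sum_le_sum_abs _ _).trans
    ((Finset.sum_le_sum fun E hE => abs_integral_mul_le (hf E hE) (hg E hE)).trans ?_)
  exact Real.sum_sqrt_mul_sqrt_le _ (fun E => integral_nonneg fun _ => sq_nonneg _)
    (fun E => integral_nonneg fun _ => sq_nonneg _)

/-! ### Traces of discrete functions -/

variable {T : Triangulation Ω} {t : Finset Pt → Pt} {k : ℕ} {K E : Finset Pt}
  {v w : (Pt → Pt) × (Pt → ℝ)} {q r : Pt → ℝ} {ν τ ε : ℝ}

theorem localPoly_mem (hv : v ∈ Vh T k) (hK : K ∈ T.elements) : localPoly k K v.1 ∈ vpoly k :=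
  localPoly_mem_vpoly (hv.1.2 K hK)

theorem normalDeriv_mem (hv : v ∈ Vh T k) (hK : K ∈ T.elements) (E : Finset Pt) :
    normalDeriv k K E v.1 ∈ vpoly (k - 1) :=
  fderiv_mem_vpoly (localPoly_mem hv hK) _

theorem normalDerivT_mem (t : Finset Pt → Pt) (hv : v ∈ Vh T k) (hK : K ∈ T.elements)
    (E : Finset Pt) : normalDerivT t k K E v.1 ∈ poly (k - 1) :=
  inner_mem_poly (normalDeriv_mem hv hK E) _

theorem memLp_tangJump (t : Finset Pt → Pt) (hv : v ∈ Vh T k) (hK : K ∈ T.elements)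
    (hE : E ∈ edgesOf K) : MemLp (tangJump t k K E v) 2 (edgeMeasure E) :=
  (memLp_edge_of_continuous (card_of_mem_edgesOf hE)
    (continuous_of_mem_poly (inner_mem_poly (localPoly_mem hv hK) (t E)))).sub
    (hv.2.1 E (T.mem_edges hK hE))

theorem isL2Proj_projJump (t : Finset Pt → Pt) (hv : v ∈ Vh T k) (hK : K ∈ T.elements)
    (hE : E ∈ edgesOf K) :
    IsL2Proj (edgeMeasure E) (k - 1) (tangJump t k K E v) (projJump t k K E v) :=
  isL2Proj_edgeProj (card_of_mem_edgesOf hE) _ (memLp_tangJump t hv hK hE)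

theorem memLp_projJump (t : Finset Pt → Pt) (hv : v ∈ Vh T k) (hK : K ∈ T.elements)
    (hE : E ∈ edgesOf K) : MemLp (projJump t k K E v) 2 (edgeMeasure E) :=
  memLp_edge_of_continuous (card_of_mem_edgesOf hE)
    (continuous_of_mem_poly (isL2Proj_projJump t hv hK hE).1)

theorem memLp_normalDerivT (t : Finset Pt → Pt) (hv : v ∈ Vh T k) (hK : K ∈ T.elements)
    (hE : E ∈ edgesOf K) : MemLp (normalDerivT t k K E v.1) 2 (edgeMeasure E) :=
  memLp_edge_of_continuous (card_of_mem_edgesOf hE)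
    (continuous_of_mem_poly (normalDerivT_mem t hv hK E))

/-- The normal derivative has degree at most `k - 1`, so it only sees the projected jump. -/
theorem boundaryIntegral_normalDerivT_mul_tangJump (t : Finset Pt → Pt) (hw : w ∈ Vh T k)
    (hv : v ∈ Vh T k) (hK : K ∈ T.elements) :
    boundaryIntegral K (fun E x => normalDerivT t k K E w.1 x * tangJump t k K E v x) =
      boundaryIntegral K (fun E x => normalDerivT t k K E w.1 x * projJump t k K E v x) := by
  refine Finset.sum_congr rfl fun E hE => ?_
  have h := (isL2Proj_projJump t hv hK hE).2 _ (normalDerivT_mem t hw hK E)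
  simp only [mul_comm (normalDerivT t k K E w.1 _)]
  exact h.symm

theorem boundaryIntegral_normalDerivT_sq_le (ht : IsTangentField T t) (hw : w ∈ Vh T k)
    (hK : K ∈ T.elements) :
    boundaryIntegral K (fun E x => normalDerivT t k K E w.1 x ^ 2) ≤
      boundaryIntegral K (fun E x => ‖normalDeriv k K E w.1 x‖ ^ 2) := by
  refine Finset.sum_le_sum fun E hE => ?_
  refine integral_mono (memLp_normalDerivT t hw hK hE).integrable_sq
    (memLp_edge_of_continuous (card_of_mem_edgesOf hE)
      (continuous_of_mem_vpoly (normalDeriv_mem hw hK E)).norm).integrable_sq fun x => ?_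
  have h := abs_real_inner_le_norm (normalDeriv k K E w.1 x) (t E)
  rw [(ht E (T.mem_edges hK hE)).1, mul_one] at h
  exact sq_le_sq.2 (h.trans (le_abs_self _))

/-! ### The contribution of a triangle to the velocity norm -/

/-- The contribution of the triangle `K` to `|||(w, w̃)|||²`, up to the factor `ν`. -/
noncomputable def elemEnergy (t : Finset Pt → Pt) (k : ℕ) (τ : ℝ) (K : Finset Pt)
    (w : (Pt → Pt) × (Pt → ℝ)) : ℝ :=
  (∫ x, gradDot (localPoly k K w.1) (localPoly k K w.1) x ∂(elemMeasure K))
    + diam K * boundaryIntegral K (fun E x => ‖normalDeriv k K E w.1 x‖ ^ 2)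
    + τ / diam K * boundaryIntegral K (fun E x => projJump t k K E w x ^ 2)

theorem diam_nonneg (K : Finset Pt) : 0 ≤ diam K := Metric.diam_nonneg

theorem integral_gradDot_nonneg (k : ℕ) (K : Finset Pt) (w : Pt → Pt) :
    0 ≤ ∫ x, gradDot (localPoly k K w) (localPoly k K w) x ∂(elemMeasure K) :=
  integral_nonneg fun _ => gradDot_self_nonneg _ _

theorem mul_normalDeriv_nonneg (k : ℕ) (K : Finset Pt) (w : Pt → Pt) :
    0 ≤ diam K * boundaryIntegral K (fun E x => ‖normalDeriv k K E w x‖ ^ 2) :=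
  mul_nonneg (diam_nonneg K) (boundaryIntegral_nonneg K fun _ _ => sq_nonneg _)

theorem mul_projJump_nonneg (hτ : 0 < τ) (t : Finset Pt → Pt) (k : ℕ) (K : Finset Pt)
    (w : (Pt → Pt) × (Pt → ℝ)) :
    0 ≤ τ / diam K * boundaryIntegral K (fun E x => projJump t k K E w x ^ 2) :=
  mul_nonneg (div_nonneg hτ.le (diam_nonneg K)) (boundaryIntegral_nonneg K fun _ _ => sq_nonneg _)

theorem integral_gradDot_le_elemEnergy (hτ : 0 < τ) (t : Finset Pt → Pt) (k : ℕ) (K : Finset Pt)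
    (w : (Pt → Pt) × (Pt → ℝ)) :
    ∫ x, gradDot (localPoly k K w.1) (localPoly k K w.1) x ∂(elemMeasure K) ≤
      elemEnergy t k τ K w := by
  have := mul_normalDeriv_nonneg k K w.1
  have := mul_projJump_nonneg hτ t k K w
  unfold elemEnergy
  linarith

theorem mul_normalDeriv_le_elemEnergy (hτ : 0 < τ) (t : Finset Pt → Pt) (k : ℕ) (K : Finset Pt)
    (w : (Pt → Pt) × (Pt → ℝ)) :
    diam K * boundaryIntegral K (fun E x => ‖normalDeriv k K E w.1 x‖ ^ 2) ≤
      elemEnergy t k τ K w := by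
  have := integral_gradDot_nonneg k K w.1
  have := mul_projJump_nonneg hτ t k K w
  unfold elemEnergy
  linarith

theorem mul_projJump_le_elemEnergy (t : Finset Pt → Pt) (k : ℕ) (K : Finset Pt)
    (w : (Pt → Pt) × (Pt → ℝ)) :
    τ / diam K * boundaryIntegral K (fun E x => projJump t k K E w x ^ 2) ≤
      elemEnergy t k τ K w := by
  have := integral_gradDot_nonneg k K w.1
  have := mul_normalDeriv_nonneg k K w.1
  unfold elemEnergy
  linarith

theorem elemEnergy_nonneg (hτ : 0 < τ) (t : Finset Pt → Pt) (k : ℕ) (K : Finset Pt)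
    (w : (Pt → Pt) × (Pt → ℝ)) : 0 ≤ elemEnergy t k τ K w :=
  (integral_gradDot_nonneg k K w.1).trans (integral_gradDot_le_elemEnergy hτ t k K w)

theorem velNorm_eq (T : Triangulation Ω) (t : Finset Pt → Pt) (k : ℕ) (hν : 0 < ν) (τ : ℝ)
    (w : (Pt → Pt) × (Pt → ℝ)) :
    velNorm T t k ν τ w = √ν * √(∑ K ∈ T.elements, elemEnergy t k τ K w) :=
  -- The summand of `velNorm` is `elemEnergy` by definition.
  Real.sqrt_mul hν.le _

/-! ### The bilinear form `a` -/

/-- Cauchy-Schwarz is applied twice: pointwise to the matrix product, then in `L²` to the pointwise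
Frobenius norms. -/
theorem abs_integral_gradDot_le (hτ : 0 < τ) (t : Finset Pt → Pt) (hw : w ∈ Vh T k)
    (hv : v ∈ Vh T k) (hK : K ∈ T.elements) :
    |∫ x, gradDot (localPoly k K w.1) (localPoly k K v.1) x ∂(elemMeasure K)| ≤
      √(elemEnergy t k τ K w) * √(elemEnergy t k τ K v) := by
  have hL : ∀ {u}, u ∈ Vh T k →
      MemLp (fun x => √(gradDot (localPoly k K u.1) (localPoly k K u.1) x)) 2 (elemMeasure K) :=
    fun hu => memLp_elem_of_continuous K
      (continuous_gradDot (localPoly_mem hu hK) (localPoly_mem hu hK)).sqrt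
  have hI := (memLp_elem_of_continuous K (continuous_gradDot (localPoly_mem hw hK)
    (localPoly_mem hv hK)).abs).integrable_sq
  calc |∫ x, gradDot (localPoly k K w.1) (localPoly k K v.1) x ∂(elemMeasure K)|
      ≤ ∫ x, |gradDot (localPoly k K w.1) (localPoly k K v.1) x| ∂(elemMeasure K) :=
        abs_integral_le_integral_abs
    _ ≤ ∫ x, √(gradDot (localPoly k K w.1) (localPoly k K w.1) x) *
          √(gradDot (localPoly k K v.1) (localPoly k K v.1) x) ∂(elemMeasure K) :=
        integral_mono_of_nonneg (Filter.Eventually.of_forall fun _ => abs_nonneg _)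
          ((hL hw).integrable_mul (hL hv))
          (Filter.Eventually.of_forall fun x => abs_gradDot_le _ _ x)
    _ ≤ _ := (le_abs_self _).trans (abs_integral_mul_le (hL hw) (hL hv))
    _ ≤ _ := by
        simp only [Real.sq_sqrt (gradDot_self_nonneg _ _)]
        gcongr <;> exact integral_gradDot_le_elemEnergy hτ t k K _

theorem abs_flux_le (hτ : 0 < τ) (ht : IsTangentField T t) (hw : w ∈ Vh T k)
    (hv : v ∈ Vh T k) (hK : K ∈ T.elements) :
    |boundaryIntegral K (fun E x => normalDerivT t k K E w.1 x * tangJump t k K E v x)| ≤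
      1 / √τ * (√(elemEnergy t k τ K w) * √(elemEnergy t k τ K v)) := by
  have hd : 0 < diam K := diam_pos (Finset.mem_filter.1 hK).2
  rw [boundaryIntegral_normalDerivT_mul_tangJump t hw hv hK]
  refine (abs_boundaryIntegral_mul_le (fun E hE => memLp_normalDerivT t hw hK hE)
    (fun E hE => memLp_projJump t hv hK hE)).trans ?_
  refine (mul_le_mul_of_nonneg_right (Real.sqrt_le_sqrt
    (boundaryIntegral_normalDerivT_sq_le ht hw hK)) (Real.sqrt_nonneg _)).trans ?_
  have hB := mul_normalDeriv_le_elemEnergy hτ t k K w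
  have hD := mul_projJump_le_elemEnergy (τ := τ) t k K v
  -- The weights `h_K` and `τ / h_K` required by the norm are inserted under the two roots. Together
  -- they contribute `√τ`, compensated by `1 / √τ`.
  calc _ = 1 / √τ * (√(diam K * boundaryIntegral K (fun E x => ‖normalDeriv k K E w.1 x‖ ^ 2)) *
        √(τ / diam K * boundaryIntegral K (fun E x => projJump t k K E v x ^ 2))) := by
        have h1 := (Real.sqrt_pos.2 hd).ne'
        have h2 := (Real.sqrt_pos.2 hτ).ne'
        rw [Real.sqrt_mul hd.le, Real.sqrt_mul (div_pos hτ hd).le, Real.sqrt_div hτ.le]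
        field_simp
    _ ≤ _ := by gcongr

theorem abs_stabilization_le (hτ : 0 < τ) (t : Finset Pt → Pt) (hw : w ∈ Vh T k)
    (hv : v ∈ Vh T k) (hK : K ∈ T.elements) :
    |τ / diam K * boundaryIntegral K (fun E x => projJump t k K E w x * projJump t k K E v x)| ≤
      √(elemEnergy t k τ K w) * √(elemEnergy t k τ K v) := by
  have hd : 0 ≤ τ / diam K := div_nonneg hτ.le (diam_nonneg K)
  rw [abs_mul, abs_of_nonneg hd]
  refine (mul_le_mul_of_nonneg_left (abs_boundaryIntegral_mul_le
    (fun E hE => memLp_projJump t hw hK hE) (fun E hE => memLp_projJump t hv hK hE)) hd).trans ?_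
  have hw' := mul_projJump_le_elemEnergy (τ := τ) t k K w
  have hv' := mul_projJump_le_elemEnergy (τ := τ) t k K v
  calc _ = √(τ / diam K * boundaryIntegral K (fun E x => projJump t k K E w x ^ 2)) *
        √(τ / diam K * boundaryIntegral K (fun E x => projJump t k K E v x ^ 2)) := by
        rw [Real.sqrt_mul hd, Real.sqrt_mul hd, mul_mul_mul_comm, Real.mul_self_sqrt hd]
    _ ≤ _ := by gcongr

/-- The gradient and stabilisation terms each contribute `1` to the constant, and the two fluxes `1
/ √τ` each. The sign `ε` enters only through `|ε| = 1`. -/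
theorem abs_formA0_le (hν : 0 < ν) (hτ : 0 < τ) (hε : ε = -1 ∨ ε = 1) (ht : IsTangentField T t)
    (hw : w ∈ Vh T k) (hv : v ∈ Vh T k) :
    |formA0 T t k ν τ ε w v| ≤
      (2 + 2 / √τ) * (velNorm T t k ν τ w * velNorm T t k ν τ v) := by
  have habs : |ε| = 1 := by rcases hε with rfl | rfl <;> simp
  have hC : 0 ≤ ν * (2 + 2 / √τ) := by positivity
  have hsum := Real.sum_sqrt_mul_sqrt_le T.elements (fun K => elemEnergy_nonneg hτ t k K w)
    (fun K => elemEnergy_nonneg hτ t k K v)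
  rw [velNorm_eq T t k hν, velNorm_eq T t k hν, mul_mul_mul_comm, Real.mul_self_sqrt hν.le,
    ← mul_assoc, mul_comm _ ν]
  refine le_trans ?_ (mul_le_mul_of_nonneg_left hsum hC)
  rw [Finset.mul_sum]
  refine (Finset.abs_sum_le_sum_abs _ _).trans (Finset.sum_le_sum fun K hK => ?_)
  have h1 := abs_integral_gradDot_le hτ t hw hv hK
  have h2 := abs_flux_le hτ ht hw hv hK
  have h3 := abs_flux_le hτ ht hv hw hK
  have h4 := abs_stabilization_le hτ t hw hv hK
  -- Puts the second flux in the shape of the first with `w` and `v` exchanged, so that `h3`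
  -- applies.
  simp only [mul_assoc ν, mul_comm (tangJump t k K _ w _), boundaryIntegral_const_mul,
    integral_const_mul]
  set G := ∫ x, gradDot (localPoly k K w.1) (localPoly k K v.1) x ∂(elemMeasure K)
  set F := boundaryIntegral K (fun E x => normalDerivT t k K E w.1 x * tangJump t k K E v x)
  set F' := boundaryIntegral K (fun E x => normalDerivT t k K E v.1 x * tangJump t k K E w x)
  set P := τ / diam K *
    boundaryIntegral K (fun E x => projJump t k K E w x * projJump t k K E v x)
  have e : ν * G - ν * F + ε * (ν * F') + ν * P = ν * (G - F + ε * F' + P) := by ring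
  rw [e, abs_mul, abs_of_pos hν]
  refine mul_le_mul_of_nonneg_left ?_ hν.le
  have h5 : |G - F + ε * F' + P| ≤ |G| + |F| + |F'| + |P| := by
    have := abs_add_le (G - F + ε * F') P
    have := abs_add_le (G - F) (ε * F')
    have := abs_sub G F
    rw [abs_mul, habs, one_mul] at *
    linarith
  rw [mul_comm (√(elemEnergy t k τ K v))] at h3
  calc _ ≤ _ := h5
    _ ≤ _ := add_le_add (add_le_add (add_le_add h1 h2) h3) h4
    _ = _ := by ring

/-! ### The bilinear forms `b` and `s` -/

theorem memLp_of_mem_Qh (hq : q ∈ Qh T k) (hK : K ∈ T.elements) : MemLp q 2 (elemMeasure K) := by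
  obtain ⟨p, hp, hqp⟩ := hq.2 K hK
  exact (memLp_elem_of_continuous K (continuous_of_mem_poly hp)).ae_eq hqp.symm

theorem l2Norm_eq (hΩ : IsLipschitzPolygon Ω) (hq : q ∈ Qh T k) :
    l2Norm Ω q = √(∑ K ∈ T.elements, ∫ x, q x ^ 2 ∂(elemMeasure K)) := by
  rw [l2Norm, T.restrict_eq_sum hΩ, integral_finsetSum_measure
    fun K hK => (memLp_of_mem_Qh hq hK).integrable_sq]

theorem abs_integral_mul_dvg_le (hτ : 0 < τ) (t : Finset Pt → Pt) (hv : v ∈ Vh T k)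
    (hq : q ∈ Qh T k) (hK : K ∈ T.elements) :
    |∫ x, q x * dvg (localPoly k K v.1) x ∂(elemMeasure K)| ≤
      √2 * (√(∫ x, q x ^ 2 ∂(elemMeasure K)) * √(elemEnergy t k τ K v)) := by
  have hp := localPoly_mem hv hK
  have hd := memLp_elem_of_continuous K (continuous_dvg hp)
  have hg : Integrable (gradDot (localPoly k K v.1) (localPoly k K v.1)) (elemMeasure K) := by
    have := (memLp_elem_of_continuous K (continuous_gradDot hp hp).sqrt).integrable_sq
    simpa only [Real.sq_sqrt (gradDot_self_nonneg _ _)] using this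
  have h : ∫ x, dvg (localPoly k K v.1) x ^ 2 ∂(elemMeasure K) ≤ 2 * elemEnergy t k τ K v := by
    refine (integral_mono hd.integrable_sq (hg.const_mul 2) fun x => dvg_sq_le _ x).trans ?_
    rw [integral_const_mul]
    exact mul_le_mul_of_nonneg_left (integral_gradDot_le_elemEnergy hτ t k K v) zero_le_two
  refine (abs_integral_mul_le (memLp_of_mem_Qh hq hK) hd).trans ?_
  rw [mul_left_comm, ← Real.sqrt_mul zero_le_two]
  gcongr

theorem abs_formB_le (hΩ : IsLipschitzPolygon Ω) (hν : 0 < ν) (hτ : 0 < τ) (t : Finset Pt → Pt)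
    (hv : v ∈ Vh T k) (hq : q ∈ Qh T k) :
    |formB T k v q| ≤ √2 * (velNorm T t k ν τ v * (1 / √ν * l2Norm Ω q)) := by
  have hsum := Real.sum_sqrt_mul_sqrt_le T.elements
    (fun K => integral_nonneg (μ := elemMeasure K) fun x => sq_nonneg (q x))
    (fun K => elemEnergy_nonneg hτ t k K v)
  have hν' := (Real.sqrt_pos.2 hν).ne'
  rw [velNorm_eq T t k hν, l2Norm_eq hΩ hq, formB, abs_neg]
  refine (Finset.abs_sum_le_sum_abs _ _).trans
    ((Finset.sum_le_sum fun K hK => abs_integral_mul_dvg_le hτ t hv hq hK).trans ?_)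
  rw [← Finset.mul_sum]
  refine (mul_le_mul_of_nonneg_left hsum (Real.sqrt_nonneg 2)).trans (le_of_eq ?_)
  field_simp

/-- Almost every point of `K` is interior to it, because a convex set has null frontier, and belongs
to no other triangle. Only one indicator in the sum survives. -/
theorem globalProj_ae_eq (hK : K ∈ T.elements) (k : ℕ) (q : Pt → ℝ) :
    globalProj T k q =ᵐ[elemMeasure K] elemProj k K q := by
  have h1 : ∀ᵐ x ∂(elemMeasure K), x ∈ interior (hull K) := by
    rw [elemMeasure, ae_restrict_iff' (isCompact_hull K).measurableSet]
    have h0 : volume (frontier (hull K)) = 0 := (convex_convexHull ℝ _).addHaar_frontier _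
    filter_upwards [measure_eq_zero_iff_ae_notMem.1 h0] with x hx hxK
    by_contra hxi
    exact hx ⟨subset_closure hxK, hxi⟩
  have h2 : ∀ᵐ x ∂(elemMeasure K), ∀ L ∈ T.elements, L ≠ K → x ∉ hull L := by
    refine (ae_ball_iff T.elements.countable_toSet).2 fun L hL => ?_
    rw [elemMeasure, ae_restrict_iff' (isCompact_hull K).measurableSet]
    by_cases hLK : L = K
    · simp [hLK]
    · filter_upwards [measure_eq_zero_iff_ae_notMem.1 (T.aedisjoint hK hL (Ne.symm hLK))]
        with x hx hxK _ hxL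
      exact hx ⟨hxK, hxL⟩
  filter_upwards [h1, h2] with x hx hx'
  rw [globalProj, Finset.sum_eq_single_of_mem K hK, indicator_of_mem hx]
  exact fun L hL hLK => indicator_of_notMem (fun h => hx' L hL hLK (interior_subset h)) _

theorem memLp_sub_globalProj (hq : q ∈ Qh T k) (hK : K ∈ T.elements) (l : ℕ) :
    MemLp (fun x => q x - globalProj T l q x) 2 (elemMeasure K) := by
  have hp := (isL2Proj_elemProj K l (memLp_of_mem_Qh hq hK)).1
  exact (memLp_of_mem_Qh hq hK).sub
    ((memLp_elem_of_continuous K (continuous_of_mem_poly hp)).ae_eq (globalProj_ae_eq hK l q).symm)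

theorem integral_sub_globalProj_sq_le (hq : q ∈ Qh T k) (hK : K ∈ T.elements) (l : ℕ) :
    ∫ x, (q x - globalProj T l q x) ^ 2 ∂(elemMeasure K) ≤ ∫ x, q x ^ 2 ∂(elemMeasure K) := by
  have hp := isL2Proj_elemProj K l (memLp_of_mem_Qh hq hK)
  refine le_of_eq_of_le (integral_congr_ae ?_) (hp.integral_sub_sq_le (memLp_of_mem_Qh hq hK)
    (memLp_elem_of_continuous K (continuous_of_mem_poly hp.1)))
  filter_upwards [globalProj_ae_eq hK l q] with x hx
  rw [hx]

theorem abs_formS_le (hΩ : IsLipschitzPolygon Ω) (hν : 0 < ν) (hr : r ∈ Qh T k)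
    (hq : q ∈ Qh T k) :
    |formS T k ν r q| ≤ (1 / √ν * l2Norm Ω r) * (1 / √ν * l2Norm Ω q) := by
  have hsum := Real.sum_sqrt_mul_sqrt_le T.elements
    (fun K => integral_nonneg (μ := elemMeasure K) fun x => sq_nonneg (r x))
    (fun K => integral_nonneg (μ := elemMeasure K) fun x => sq_nonneg (q x))
  have hI : ∀ K ∈ T.elements, Integrable (fun x => (r x - globalProj T (k - 1) r x) *
      (q x - globalProj T (k - 1) q x)) (elemMeasure K) :=
    fun K hK => (memLp_sub_globalProj hr hK _).integrable_mul (memLp_sub_globalProj hq hK _)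
  -- The scaling `1 / ν` of `s` is shared equally between the two pressure norms.
  have hν1 : 1 / √ν * (1 / √ν) = 1 / ν := by
    rw [div_mul_div_comm, Real.mul_self_sqrt hν.le, one_mul]
  rw [mul_mul_mul_comm, hν1, l2Norm_eq hΩ hr, l2Norm_eq hΩ hq, formS, abs_mul,
    abs_of_pos (one_div_pos.2 hν), T.restrict_eq_sum hΩ, integral_finsetSum_measure hI]
  refine mul_le_mul_of_nonneg_left ?_ (one_div_pos.2 hν).le
  refine (Finset.abs_sum_le_sum_abs _ _).trans
    ((Finset.sum_le_sum fun K hK => ?_).trans hsum)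
  refine (abs_integral_mul_le (memLp_sub_globalProj hr hK _)
    (memLp_sub_globalProj hq hK _)).trans ?_
  gcongr √?_ * √?_
  · exact integral_sub_globalProj_sq_le hr hK _
  · exact integral_sub_globalProj_sq_le hq hK _

end HdG

/-! ### Continuity of the stabilised form. -/

open HdG in
theorem mainTheorem6 (Ω : Set Pt) (hΩ : IsLipschitzPolygon Ω)
    {ι : Type*} (T : ι → Triangulation Ω) (hT : IsRegularFamily T)
    (k : ℕ) (hk : 1 ≤ k) (τ : ℝ) (hτ : 0 < τ) (ε : ℝ) (hε : ε = -1 ∨ ε = 1) :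
    ∃ C : ℝ, 0 < C ∧
      ∀ (ν : ℝ), 0 < ν → ∀ (i : ι) (t : Finset Pt → Pt), IsTangentField (T i) t →
        ∀ w ∈ Vh (T i) k, ∀ v ∈ Vh (T i) k, ∀ r ∈ Qh (T i) k, ∀ q ∈ Qh (T i) k,
          |formA (T i) t k ν τ ε w r v q| ≤
            C * fullNorm (T i) t k ν τ w r * fullNorm (T i) t k ν τ v q := by
  -- The summands come from `a`, `b` and `s`. The two occurrences of `b` share one `√2`, since they
  -- bound different cross terms of the product of norms.
  refine ⟨(2 + 2 / √τ) + √2 + 1, by positivity, ?_⟩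
  intro ν hν i t ht w hw v hv r hr q hq
  have h1 := abs_formA0_le hν hτ hε ht hw hv
  have h2 := abs_formB_le hΩ hν hτ t hv hr
  have h3 := abs_formB_le hΩ hν hτ t hw hq
  have h4 := abs_formS_le hΩ hν hr hq
  have hx : 0 ≤ velNorm (T i) t k ν τ w := Real.sqrt_nonneg _
  have hy : 0 ≤ velNorm (T i) t k ν τ v := Real.sqrt_nonneg _
  have hx' : 0 ≤ 1 / √ν * l2Norm Ω r := by unfold l2Norm; positivity
  have hy' : 0 ≤ 1 / √ν * l2Norm Ω q := by unfold l2Norm; positivity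
  unfold formA fullNorm
  generalize formA0 (T i) t k ν τ ε w v = α at *
  generalize formB (T i) k v r = β at *
  generalize formB (T i) k w q = γ at *
  generalize formS (T i) k ν r q = δ at *
  generalize velNorm (T i) t k ν τ w = x at *
  generalize velNorm (T i) t k ν τ v = y at *
  generalize 1 / √ν * l2Norm Ω r = x' at *
  generalize 1 / √ν * l2Norm Ω q = y' at *
  have h5 : |α + β + γ - δ| ≤ |α| + |β| + |γ| + |δ| := by
    have := abs_sub (α + β + γ) δ
    have := abs_add_le (α + β) γ
    have := abs_add_le α β
    linarith
  have hc : 0 ≤ 2 + 2 / √τ := by positivity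
  have hs : 0 ≤ √2 := Real.sqrt_nonneg 2
  refine h5.trans ?_
  generalize 2 + 2 / √τ = c at *
  generalize √2 = s at *
  -- This is exactly the expanded product `(c + s + 1) (x + x') (y + y')` minus the sum of the four
  -- bounds.
  have : 0 ≤ c * (x * y' + x' * y + x' * y') + s * (x * y + x' * y') +
    (x * y + x * y' + x' * y) := by positivity
  nlinarith
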